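/- **Theorem (hBN–graphene bilayer).** Let $q:[0,1]\to\mathbb R$ be continuous with $q(1-x)=q(x)$, let $0<t_0\le 1$, and let $\alpha_N,\alpha_B\in\mathbb R$ be distinct and nonzero with $\alpha_B=-\alpha_N$. For $\theta=(\theta_1,\theta_2)\in\mathcal B=[-\pi,\pi]^2$ put $F(\theta)=1+e^{i\theta_1}+e^{i\theta_2}$. *The model.* A real number $\lambda$ that is not a Dirichlet eigenvalue of $-\frac{d^2}{dx^2}+q$ on $[0,1]$ has a unique solution $\varphi_\lambda$ of $-\varphi''+q\varphi=\lambda\varphi$ on $[0,1]$ with $\varphi_\lambda(0)=0$, $\varphi_\lambda(1)=1$. Put $\eta(\lambda)=\varphi_\lambda'(1)/\varphi_\lambda'(0)$. The Floquet problem at $\theta$ asks for functions $u_{ki}$ ($k=1,2$, $i=1,2,3$; layer edges) and $w_1,w_2$ (weak edges between the layers) on $[0,1]$, not all zero, each solving $-u''+qu=\lambda u$, with $$u_{k1}(0)=u_{k2}(0)=u_{k3}(0)=\tfrac{w_k(0)}{t_0}=:A_k,\qquad u_{k1}(1)=e^{i\theta_1}u_{k2}(1)=e^{i\theta_2}u_{k3}(1)=\tfrac{w_{3-k}(1)}{t_0}=:B_k,$$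 $$\sum_i u_{ki}'(0)+t_0w_k'(0)=\delta_{A,k}A_k,\qquad -u_{k1}'(1)-e^{i\theta_1}u_{k2}'(1)-e^{i\theta_2}u_{k3}'(1)-t_0w_{3-k}'(1)=\delta_{B,k}B_k ,$$ where the vertex parameters are given by $\delta=\alpha\,\varphi_\lambda'(0)$, with $\alpha=\alpha_N$ at $A_1$, $\alpha=\alpha_B$ at $B_1$ (hBN layer), and $\alpha=\alpha_C=0$ at $A_2,B_2$ (graphene layer). The dispersion relation is the set of all $(\theta,\lambda)$, with $\theta\in\mathcal B$ and $\lambda$ not a Dirichlet eigenvalue, for which this problem is solvable; it is described through the values $\eta(\lambda)$. *Conclusion.* The dispersion relation has a gap at $F=0$, of width $$g(\alpha_N,t_0)=\sqrt2\;\frac{\sqrt{2t_0^4+\alpha_N^2-\sqrt{4\alpha_N^2t_0^4+\alpha_N^4}}}{3+t_0^2}$$ in the variable $\eta$. Precisely, let $G(\alpha_N,t_0)$ be the same expression with $+$ in place of $-$ in front of the inner root. Then: 1. $F$ has a zero in $\mathcal B$, and $0<g<G$. 2. If $\theta\in\mathcal B$, $F(\theta)=0$, and $\lambda$ is not a Dirichlet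 eigenvalue, then $(\theta,\lambda)$ is in the dispersion relation if and only if $\eta(\lambda)\in\{\pm g/2,\pm G/2\}$. So the four branches do not touch at $F=0$, and no value lies in $(-g/2,g/2)$. 3. Both edges of the gap are attained: there are $\lambda_1<\lambda_2$ such that $[\lambda_1,\lambda_2]$ contains no Dirichlet eigenvalue, $\eta(\lambda_1)=g/2$, $\eta(\lambda_2)=-g/2$, and for every $\theta\in\mathcal B$ with $F(\theta)=0$ the points $(\theta,\lambda_1)$, $(\theta,\lambda_2)$ are in the dispersion relation while no $(\theta,\lambda)$ with $\lambda_1<\lambda<\lambda_2$ is. 4. The positive and negative branches never meet on $\mathcal B$: there is $\varepsilon>0$ with $|\eta(\lambda)|\ge\varepsilon$ for every $(\theta,\lambda)$ in the dispersion relation. -/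

import Mathlib

open Set

noncomputable section

/-- `u` is a classical solution of `-u'' + q u = E u` on the edge `[0,1]`, and `v` is its derivative.
(For continuous `q` every `H²` solution on `[0,1]` is of this kind.) -/
def IsEdgeSolution {V : Type*} [NormedAddCommGroup V] [NormedSpace ℝ V]
    (q : ℝ → ℝ) (E : ℝ) (u v : ℝ → V) : Prop :=
  ∀ x ∈ Icc (0 : ℝ) 1,
    HasDerivWithinAt u (v x) (Icc 0 1) x ∧
    HasDerivWithinAt v ((q x - E) • u x) (Icc 0 1) x

/-- `E` belongs to the spectrum of the Dirichlet operator `-d²/dx² + q` on `[0,1]`. -/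
def IsDirichletEigenvalue (q : ℝ → ℝ) (E : ℝ) : Prop :=
  ∃ u v : ℝ → ℝ, IsEdgeSolution q E u v ∧ u 0 = 0 ∧ u 1 = 0 ∧ ∃ x ∈ Icc (0 : ℝ) 1, u x ≠ 0

/-- `φ` is the solution `φ_{E,1}` of the edge equation with `φ(0) = 0`, `φ(1) = 1`; `dφ` is its
derivative. It exists and is unique on `[0,1]` exactly when `E` is not a Dirichlet eigenvalue. -/
def IsPhiOne (q : ℝ → ℝ) (E : ℝ) (φ dφ : ℝ → ℝ) : Prop :=
  IsEdgeSolution q E φ dφ ∧ φ 0 = 0 ∧ φ 1 = 1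

/-- Floquet multipliers carried by the end points of the three edges of a hexagonal layer that
belong to the fundamental domain. -/
def floquetPhase (θ : ℝ × ℝ) : Fin 3 → ℂ :=
  ![1, Complex.exp (θ.1 * Complex.I), Complex.exp (θ.2 * Complex.I)]

/-- `F(θ) = 1 + e^{iθ₁} + e^{iθ₂}`. -/
def structureFactor (θ : ℝ × ℝ) : ℂ :=
  1 + Complex.exp (θ.1 * Complex.I) + Complex.exp (θ.2 * Complex.I)

/-- The Brillouin zone `[-π, π]²`. -/
def brillouinZone : Set (ℝ × ℝ) :=
  Icc (-Real.pi) Real.pi ×ˢ Icc (-Real.pi) Real.pi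

/-- A solution of the Floquet problem `H(θ) u = E u` on the fundamental domain of the bilayer.
Layer `k : Fin 2` has a type-A vertex (value `A k`, the initial point `0` of the layer edges
`(k, i)`, `i : Fin 3`) and a type-B vertex (value `B k`, their end point `1`). The weak edge `0`
runs from the A vertex of layer `0` to the B vertex of layer `1`, the weak edge `1` from the
A vertex of layer `1` to the B vertex of layer `0`. `u k i`, `du k i` are the function and its
derivative on the layer edges, `w j`, `dw j` those on the weak edges; `δA k`, `δB k` are the Robin
parameters of the vertices and `t₀` is the interaction parameter. -/
structure IsFloquetSolution (q : ℝ → ℝ) (t₀ : ℝ) (δA δB : Fin 2 → ℝ) (θ : ℝ × ℝ) (E : ℝ)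
    (u du : Fin 2 → Fin 3 → ℝ → ℂ) (w dw : Fin 2 → ℝ → ℂ) (A B : Fin 2 → ℂ) : Prop where
  layer_eq : ∀ k i, IsEdgeSolution q E (u k i) (du k i)
  weak_eq : ∀ j, IsEdgeSolution q E (w j) (dw j)
  -- weighted continuity at the vertices, with the cyclic Floquet condition
  cont_A : ∀ k i, u k i 0 = A k
  cont_B : ∀ k i, floquetPhase θ i * u k i 1 = B k
  cont_weak_A : ∀ k, w k 0 / (t₀ : ℂ) = A k
  cont_weak_B : ∀ k, w (1 - k) 1 / (t₀ : ℂ) = B k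
  -- total flow at the vertices
  flow_A : ∀ k, (∑ i, du k i 0) + t₀ * dw k 0 = δA k * A k
  flow_B : ∀ k, -(∑ i, floquetPhase θ i * du k i 1) - t₀ * dw (1 - k) 1 = δB k * B k

/-- `E` belongs to the (purely discrete) spectrum of the Floquet operator `H(θ)`: the Floquet
problem has a solution that is not identically zero. -/
def IsFloquetEigenvalue (q : ℝ → ℝ) (t₀ : ℝ) (δA δB : Fin 2 → ℝ) (θ : ℝ × ℝ) (E : ℝ) : Prop :=
  ∃ (u du : Fin 2 → Fin 3 → ℝ → ℂ) (w dw : Fin 2 → ℝ → ℂ) (A B : Fin 2 → ℂ),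
    IsFloquetSolution q t₀ δA δB θ E u du w dw A B ∧
    ∃ x ∈ Icc (0 : ℝ) 1, (∃ k i, u k i x ≠ 0) ∨ (∃ j, w j x ≠ 0)

/-- The dispersion relation of the bilayer with normalized vertex parameters
`α = δ / φ_{E,1}'(0)`: the energy `E`, not a Dirichlet eigenvalue, is an eigenvalue of `H(θ)` with
Robin parameters `δ = α φ_{E,1}'(0)`, and `η = η(E) = φ_{E,1}'(1) / φ_{E,1}'(0)`. -/
def InDispersion (q : ℝ → ℝ) (t₀ : ℝ) (αA αB : Fin 2 → ℝ) (θ : ℝ × ℝ) (E η : ℝ) : Prop :=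
  ¬ IsDirichletEigenvalue q E ∧
  ∃ φ dφ : ℝ → ℝ, IsPhiOne q E φ dφ ∧ η = dφ 1 / dφ 0 ∧
    IsFloquetEigenvalue q t₀ (fun k => αA k * dφ 0) (fun k => αB k * dφ 0) θ E

/-- The dispersion relation of hBN (layer `0`) over graphene (layer `1`, parameter `0`). -/
def InHBNGrapheneDispersion (q : ℝ → ℝ) (t₀ αN αB : ℝ) (θ : ℝ × ℝ) (E η : ℝ) : Prop :=
  InDispersion q t₀ ![αN, 0] ![αB, 0] θ E η

/-- `g(α, t₀)`, the distance of the two inner branches at `F = 0`. -/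
def gapWidth (α t₀ : ℝ) : ℝ :=
  √2 * √(2 * t₀ ^ 4 + α ^ 2 - √(4 * α ^ 2 * t₀ ^ 4 + α ^ 4)) / (3 + t₀ ^ 2)

/-- The distance of the two outer branches at `F = 0`. -/
def outerWidth (α t₀ : ℝ) : ℝ :=
  √2 * √(2 * t₀ ^ 4 + α ^ 2 + √(4 * α ^ 2 * t₀ ^ 4 + α ^ 4)) / (3 + t₀ ^ 2)

end

/-! Off the Dirichlet spectrum an edge solution is fixed by its two end values, and evenness of q
makes its end slopes combinations of φ'(0) and φ'(1) (`IsPhiOne.representation`). Dividing the flow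
conditions by φ'(0) leaves a 4×4 linear system for the vertex values, where the energy enters only
through μ = (3+t₀²)η (`isFloquetEigenvalue_iff`). Its determinant is a quadratic in μ²
(`IsVertexSolution.characteristic_eq`). At F = 0 it factors as (μ²+αμ-t₀⁴)(μ²-αμ-t₀⁴), whose roots
are η = ±g/2, ±G/2. For general F its constant term α²|F|² + |F²-t₀⁴|² is bounded below, since the
two squares are never small together; this keeps η away from 0.

To attain the gap edges, η is identified with s'(1), where s(0) = 0, s'(0) = 1
(`IsPhiOne.deriv_ratio_eq`). This quantity is continuous in E, and at high energies k² with sin k =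
0 it lies within 1/2 of cos k, so it passes from at least 1/2 to at most -1/2, while g/2 < 1/2.
Symmetry forces s'(1) = ±1 at a Dirichlet eigenvalue, so a crossing of [-g/2, g/2] meets none. -/

/-! ### The edge equation: existence, uniqueness, dependence on the energy. -/

section EdgeODE

variable {V : Type*} [NormedAddCommGroup V] [NormedSpace ℝ V]

/-- Grönwall's inequality for the first order system of an inhomogeneous second order equation. -/
theorem edge_gronwall {u v r : ℝ → V} {a : ℝ → ℝ} {K δ ε : ℝ} (hK : 1 ≤ K) (hε : 0 ≤ ε)
    (hu : ∀ x ∈ Icc (0 : ℝ) 1, HasDerivWithinAt u (v x) (Icc 0 1) x)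
    (hv : ∀ x ∈ Icc (0 : ℝ) 1, HasDerivWithinAt v (a x • u x + r x) (Icc 0 1) x)
    (ha : ∀ x ∈ Icc (0 : ℝ) 1, |a x| ≤ K) (hr : ∀ x ∈ Icc (0 : ℝ) 1, ‖r x‖ ≤ ε)
    (hδ : ‖(u 0, v 0)‖ ≤ δ) :
    ∀ x ∈ Icc (0 : ℝ) 1, ‖(u x, v x)‖ ≤ gronwallBound δ K ε x := by
  intro x hx
  have := norm_le_gronwallBound_of_norm_deriv_right_le (f := fun x => (u x, v x))
    (f' := fun x => (v x, a x • u x + r x)) (δ := δ) (K := K) (ε := ε) (a := 0) (b := 1)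
    (fun x hx => ((hu x hx).continuousWithinAt.prodMk (hv x hx).continuousWithinAt))
    (fun x hx => by
      have hx' : x ∈ Icc (0 : ℝ) 1 := Ico_subset_Icc_self hx
      exact ((hu x hx').prodMk (hv x hx')).mono_of_mem_nhdsWithin (Icc_mem_nhdsGE_of_mem hx))
    hδ
    (fun x hx => by
      have hx' : x ∈ Icc (0 : ℝ) 1 := Ico_subset_Icc_self hx
      have h1 : ‖u x‖ ≤ ‖(u x, v x)‖ := norm_fst_le (u x, v x)
      have h2 : ‖v x‖ ≤ ‖(u x, v x)‖ := norm_snd_le (u x, v x)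
      have h0 := norm_nonneg (u x, v x)
      refine norm_prod_le_iff.2 ⟨?_, ?_⟩
      · change ‖v x‖ ≤ _
        nlinarith
      · change ‖a x • u x + r x‖ ≤ _
        calc ‖a x • u x + r x‖ ≤ ‖a x • u x‖ + ‖r x‖ := norm_add_le _ _
          _ ≤ K * ‖(u x, v x)‖ + ε := by
            rw [norm_smul, Real.norm_eq_abs]
            have := hr x hx'
            have := mul_le_mul (ha x hx') h1 (norm_nonneg _) (by linarith)
            linarith) x hx
  simpa using this

theorem ContinuousOn.exists_abs_le_unitInterval {q : ℝ → ℝ} (hq : ContinuousOn q (Icc 0 1)) :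
    ∃ Q : ℝ, 0 ≤ Q ∧ ∀ x ∈ Icc (0 : ℝ) 1, |q x| ≤ Q := by
  obtain ⟨Q, hQ⟩ := isCompact_Icc.exists_bound_of_continuousOn hq
  exact ⟨|Q|, abs_nonneg _, fun x hx => (hQ x hx).trans (le_abs_self _)⟩

namespace IsEdgeSolution

variable {q : ℝ → ℝ} {E : ℝ} {u v u' v' : ℝ → V}

theorem add (h : IsEdgeSolution q E u v) (h' : IsEdgeSolution q E u' v') :
    IsEdgeSolution q E (fun x => u x + u' x) (fun x => v x + v' x) := fun x hx =>
  ⟨(h x hx).1.add (h' x hx).1, by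
    have := (h x hx).2.add (h' x hx).2
    rwa [← smul_add] at this⟩

theorem clm_comp {W : Type*} [NormedAddCommGroup W] [NormedSpace ℝ W] (T : V →L[ℝ] W)
    (h : IsEdgeSolution q E u v) :
    IsEdgeSolution q E (fun x => T (u x)) (fun x => T (v x)) := fun x hx =>
  ⟨T.hasFDerivAt.comp_hasDerivWithinAt x (h x hx).1, by
    have := T.hasFDerivAt.comp_hasDerivWithinAt x (h x hx).2
    rwa [map_smul] at this⟩

theorem sub (h : IsEdgeSolution q E u v) (h' : IsEdgeSolution q E u' v') :
    IsEdgeSolution q E (fun x => u x - u' x) (fun x => v x - v' x) := fun x hx =>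
  ⟨(h x hx).1.sub (h' x hx).1, by
    have := (h x hx).2.sub (h' x hx).2
    rwa [← smul_sub] at this⟩

/-- The second derivative is unchanged by x ↦ 1 - x and q is even. This one symmetry supplies both
φ(1 - x) as second basis solution and the value ±1 of s'(1) at Dirichlet eigenvalues. -/
theorem reflect (hq_even : ∀ x ∈ Icc (0 : ℝ) 1, q (1 - x) = q x) (h : IsEdgeSolution q E u v) :
    IsEdgeSolution q E (fun x => u (1 - x)) (fun x => -v (1 - x)) := by
  intro x hx
  have hx' : 1 - x ∈ Icc (0 : ℝ) 1 := ⟨by linarith [hx.2], by linarith [hx.1]⟩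
  have hm : MapsTo (fun x : ℝ => 1 - x) (Icc 0 1) (Icc 0 1) := fun y hy =>
    ⟨by linarith [hy.2], by linarith [hy.1]⟩
  have hd : HasDerivWithinAt (fun x : ℝ => 1 - x) (-1) (Icc 0 1) x :=
    ((hasDerivAt_id x).const_sub 1).hasDerivWithinAt
  refine ⟨?_, ?_⟩
  · exact ((h (1 - x) hx').1.scomp x hd hm).congr_deriv (by simp)
  · exact ((h (1 - x) hx').2.scomp x hd hm).neg.congr_deriv (by simp [hq_even x hx])

theorem continuousOn_fst (h : IsEdgeSolution q E u v) : ContinuousOn u (Icc 0 1) :=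
  fun x hx => (h x hx).1.continuousWithinAt

/-- On the edge, the second component is determined by the first one. -/
theorem snd_eq_of_fst_eqOn (h : IsEdgeSolution q E u v) (h' : IsEdgeSolution q E u' v')
    (he : EqOn u u' (Icc 0 1)) : EqOn v v' (Icc 0 1) := fun x hx =>
  (uniqueDiffOn_Icc (zero_lt_one' ℝ) x hx).eq_deriv _ (h x hx).1
    ((h' x hx).1.congr he (he hx))

/-- Uniqueness for the initial value problem. -/
theorem eqOn_of_initial (hq : ContinuousOn q (Icc 0 1)) (h : IsEdgeSolution q E u v)
    (h' : IsEdgeSolution q E u' v') (h0 : u 0 = u' 0) (h1 : v 0 = v' 0) :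
    EqOn u u' (Icc 0 1) ∧ EqOn v v' (Icc 0 1) := by
  obtain ⟨Q, hQ0, hQ⟩ := hq.exists_abs_le_unitInterval
  have hs := h.sub h'
  have key := edge_gronwall (u := fun x => u x - u' x) (v := fun x => v x - v' x) (r := fun _ => 0)
    (a := fun x => q x - E) (K := Q + |E| + 1) (δ := 0) (ε := 0)
    (by linarith [abs_nonneg E]) le_rfl (fun x hx => (hs x hx).1)
    (fun x hx => by simpa using (hs x hx).2)
    (fun x hx => by linarith [hQ x hx, abs_sub (q x) E]) (by simp) (by simp [h0, h1])
  have key' : ∀ x ∈ Icc (0 : ℝ) 1, (u x - u' x, v x - v' x) = 0 := fun x hx => by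
    have := key x hx
    rw [gronwallBound_ε0_δ0] at this
    exact norm_le_zero_iff.1 this
  exact ⟨fun x hx => sub_eq_zero.1 (congrArg Prod.fst (key' x hx)),
    fun x hx => sub_eq_zero.1 (congrArg Prod.snd (key' x hx))⟩

end IsEdgeSolution

/-- The solution of the edge equation with `u(0) = 0`, `u'(0) = 1` exists. -/
theorem exists_sine_solution {q : ℝ → ℝ} (hq : ContinuousOn q (Icc 0 1)) (E : ℝ) :
    ∃ u v : ℝ → ℝ, IsEdgeSolution q E u v ∧ u 0 = 0 ∧ v 0 = 1 := by
  obtain ⟨Q, hQ0, hQ⟩ := hq.exists_abs_le_unitInterval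
  obtain ⟨K, hK⟩ : ∃ K : NNReal, (K : ℝ) = Q + |E| + 1 := ⟨⟨Q + |E| + 1, by positivity⟩, rfl⟩
  have hK1 : (1 : ℝ) ≤ K := by rw [hK]; linarith [abs_nonneg E]
  have hqK : ∀ x ∈ Icc (0 : ℝ) 1, |q x - E| ≤ K := fun x hx => by
    rw [hK]; linarith [hQ x hx, abs_sub (q x) E]
  -- Truncating the unknowns at height R makes the field bounded by K * R, so Picard–Lindelöf covers
  -- all of [0,1] at once. Grönwall from initial norm 1 gives the bound exp K = R, so the truncation
  -- is never active.
  obtain ⟨R, hR⟩ : ∃ R : NNReal, (R : ℝ) = Real.exp K := ⟨⟨Real.exp K, by positivity⟩, rfl⟩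
  have hR0 : (0 : ℝ) ≤ R := R.2
  let clip : ℝ → ℝ := fun y => max (-R) (min R y)
  have clip_eq : ∀ y : ℝ, |y| ≤ R → clip y = y := fun y hy => by
    obtain ⟨h1, h2⟩ := abs_le.1 hy
    simp [clip, h1, h2]
  have clip_le : ∀ y, |clip y| ≤ R := fun y =>
    abs_le.2 ⟨le_max_left _ _, max_le (by linarith) (min_le_left _ _)⟩
  have clip_lip : ∀ y z, |clip y - clip z| ≤ |y - z| := fun y z => by
    calc |clip y - clip z| ≤ |min (R : ℝ) y - min (R : ℝ) z| := by
          simpa [clip] using abs_max_sub_max_le_max (-(R : ℝ)) (min R y) (-R) (min R z)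
      _ ≤ |y - z| := by
        simpa using abs_min_sub_min_le_max (R : ℝ) y R z
  have clip_le_abs : ∀ y, |clip y| ≤ |y| := fun y => by
    have := clip_lip y 0
    rwa [clip_eq 0 (by simp), sub_zero, sub_zero] at this
  let f : ℝ → ℝ × ℝ → ℝ × ℝ := fun t y => (clip y.2, (q t - E) * clip y.1)
  have hf : IsPicardLindelof f (tmin := 0) (tmax := 1) ⟨0, by simp⟩ ((0 : ℝ), (1 : ℝ))
      (K * R) 0 (K * R) K := by
    refine ⟨?_, ?_, ?_, ?_⟩
    · intro t ht
      refine (LipschitzWith.of_dist_le_mul fun y z => ?_).lipschitzOnWith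
      rw [dist_eq_norm, dist_eq_norm]
      have h1 : |y.1 - z.1| ≤ ‖y - z‖ := norm_fst_le (y - z)
      have h2 : |y.2 - z.2| ≤ ‖y - z‖ := norm_snd_le (y - z)
      refine norm_prod_le_iff.2 ⟨?_, ?_⟩
      · change |clip y.2 - clip z.2| ≤ _
        nlinarith [clip_lip y.2 z.2, norm_nonneg (y - z)]
      · change |(q t - E) * clip y.1 - (q t - E) * clip z.1| ≤ _
        rw [← mul_sub, abs_mul]
        exact mul_le_mul (hqK t ht) ((clip_lip _ _).trans h1) (abs_nonneg _) (by linarith)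
    · intro y _
      exact continuousOn_const.prodMk ((hq.sub continuousOn_const).mul continuousOn_const)
    · intro t ht y _
      refine norm_prod_le_iff.2 ⟨?_, ?_⟩
      · change |clip y.2| ≤ _
        push_cast
        nlinarith [clip_le y.2]
      · change |(q t - E) * clip y.1| ≤ _
        rw [abs_mul]
        push_cast
        exact mul_le_mul (hqK t ht) (clip_le _) (abs_nonneg _) (by linarith)
    · simp
  obtain ⟨X, hX0, hX⟩ := hf.exists_eq_forall_mem_Icc_hasDerivWithinAt₀
  replace hX0 : X 0 = (0, 1) := hX0
  have hbound : ∀ x ∈ Icc (0 : ℝ) 1, ‖X x‖ ≤ R := by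
    intro x hx
    have := norm_le_gronwallBound_of_norm_deriv_right_le (f := X) (f' := fun x => f x (X x))
      (δ := 1) (K := K) (ε := 0) (a := 0) (b := 1)
      (fun x hx => (hX x hx).continuousWithinAt)
      (fun x hx => (hX x (Ico_subset_Icc_self hx)).mono_of_mem_nhdsWithin
        (Icc_mem_nhdsGE_of_mem hx))
      (by simp [hX0])
      (fun x hx => by
        have h1 : |(X x).1| ≤ ‖X x‖ := norm_fst_le (X x)
        have h2 : |(X x).2| ≤ ‖X x‖ := norm_snd_le (X x)
        rw [add_zero]
        refine norm_prod_le_iff.2 ⟨?_, ?_⟩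
        · change |clip (X x).2| ≤ _
          nlinarith [clip_le_abs (X x).2, norm_nonneg (X x)]
        · change |(q x - E) * clip (X x).1| ≤ _
          rw [abs_mul]
          exact mul_le_mul (hqK x (Ico_subset_Icc_self hx)) ((clip_le_abs _).trans h1)
            (abs_nonneg _) (by linarith)) x hx
    rw [gronwallBound_ε0, one_mul, sub_zero] at this
    refine this.trans ?_
    rw [hR]
    exact Real.exp_le_exp.2 (by nlinarith [hx.2])
  refine ⟨fun x => (X x).1, fun x => (X x).2, fun x hx => ?_, by simp [hX0], by simp [hX0]⟩
  have hd := hX x hx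
  have e : f x (X x) = ((X x).2, (q x - E) • (X x).1) := by
    simp only [f, smul_eq_mul]
    rw [clip_eq _ ((norm_snd_le (X x)).trans (hbound x hx)),
      clip_eq _ ((norm_fst_le (X x)).trans (hbound x hx))]
  rw [e] at hd
  exact ⟨(ContinuousLinearMap.fst ℝ ℝ ℝ).hasFDerivAt.comp_hasDerivWithinAt x hd,
    (ContinuousLinearMap.snd ℝ ℝ ℝ).hasFDerivAt.comp_hasDerivWithinAt x hd⟩

/-- The end point derivative of the sine-type solution depends continuously on the energy. -/
theorem continuous_sine_deriv_one {q : ℝ → ℝ} (hq : ContinuousOn q (Icc 0 1)) {s v : ℝ → ℝ → ℝ}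
    (hs : ∀ E, IsEdgeSolution q E (s E) (v E)) (h0 : ∀ E, s E 0 = 0) (h1 : ∀ E, v E 0 = 1) :
    Continuous fun E => v E 1 := by
  obtain ⟨Q, hQ0, hQ⟩ := hq.exists_abs_le_unitInterval
  rw [continuous_iff_continuousAt]
  intro E
  obtain ⟨M, hM0, hM⟩ := (hs E).continuousOn_fst.exists_abs_le_unitInterval
  have hb : ∀ᶠ E' in nhds E,
      dist (v E' 1) (v E 1) ≤ gronwallBound 0 (Q + |E| + 2) (|E - E'| * M) 1 := by
    filter_upwards [Metric.ball_mem_nhds E one_pos] with E' hE'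
    rw [Metric.mem_ball, Real.dist_eq] at hE'
    -- The difference solves the equation at energy E' with source (E - E') s_E. The constant Q +
    -- |E| + 2 serves all E' within distance 1 of E.
    have hsub := edge_gronwall (u := fun x => s E' x - s E x) (v := fun x => v E' x - v E x)
      (r := fun x => (E - E') * s E x) (a := fun x => q x - E') (K := Q + |E| + 2) (δ := 0)
      (ε := |E - E'| * M) (by linarith [abs_nonneg E]) (by positivity)
      (fun x hx => (hs E' x hx).1.sub (hs E x hx).1)
      (fun x hx => by
        refine ((hs E' x hx).2.sub (hs E x hx).2).congr_deriv ?_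
        simp only [smul_eq_mul]; ring)
      (fun x hx => by
        have h3 : |E'| ≤ |E| + 1 := by linarith [abs_sub_abs_le_abs_sub E' E]
        linarith [hQ x hx, abs_sub (q x) E'])
      (fun x hx => by
        rw [Real.norm_eq_abs, abs_mul]
        exact mul_le_mul_of_nonneg_left (hM x hx) (abs_nonneg _))
      (by simp [h0, h1]) 1 (by simp)
    exact (norm_snd_le (s E' 1 - s E 1, v E' 1 - v E 1)).trans hsub
  have ht : Filter.Tendsto (fun E' => gronwallBound 0 (Q + |E| + 2) (|E - E'| * M) 1)
      (nhds E) (nhds 0) := by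
    have hc : Continuous fun E' => gronwallBound 0 (Q + |E| + 2) (|E - E'| * M) 1 :=
      (gronwallBound_continuous_ε 0 (Q + |E| + 2) 1).comp (by fun_prop)
    have := hc.tendsto E
    simpa [gronwallBound_ε0_δ0] using this
  exact tendsto_iff_dist_tendsto_zero.2
    (squeeze_zero' (Filter.Eventually.of_forall fun _ => dist_nonneg) hb ht)

/-- For an even potential, the sine-type solution at a Dirichlet eigenvalue has `u'(1)² = 1`. -/
theorem sine_deriv_one_sq_of_isDirichletEigenvalue {q : ℝ → ℝ} (hq : ContinuousOn q (Icc 0 1))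
    (hq_even : ∀ x ∈ Icc (0 : ℝ) 1, q (1 - x) = q x) {E : ℝ} {s v : ℝ → ℝ}
    (hs : IsEdgeSolution q E s v) (h0 : s 0 = 0) (h1 : v 0 = 1)
    (hE : IsDirichletEigenvalue q E) : v 1 ^ 2 = 1 := by
  obtain ⟨u, u', hu, hu0, hu1, x, hx, hux⟩ := hE
  have smul_sol : ∀ c : ℝ, IsEdgeSolution q E (fun x => c * s x) (fun x => c * v x) := fun c =>
    hs.clm_comp (ContinuousLinearMap.mul ℝ ℝ c)
  have e1 := (hu.eqOn_of_initial hq (smul_sol (u' 0)) (by simp [hu0, h0]) (by simp [h1])).1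
  have hs1 : s 1 = 0 := by
    have h2 := e1 (by simp : (1 : ℝ) ∈ Icc (0 : ℝ) 1)
    rw [hu1] at h2
    rcases mul_eq_zero.1 h2.symm with h3 | h3
    · exact absurd (by simp [e1 hx, h3]) hux
    · exact h3
  -- The reflection of s starts with value 0 and slope -s'(1), so it is -s'(1) times s; comparing
  -- slopes at 1 gives s'(1)² = 1.
  have e2 := ((hs.reflect hq_even).eqOn_of_initial hq (smul_sol (-v 1))
    (by simp [hs1, h0]) (by simp [h1])).2 (by simp : (1 : ℝ) ∈ Icc (0 : ℝ) 1)
  simp only [sub_self, h1] at e2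
  linarith [e2]

/-- High-energy asymptotics of the sine-type solution at the energies `k²` with `sin k = 0`. -/
theorem abs_sine_deriv_one_sub_cos_le {q : ℝ → ℝ} {Q k : ℝ}
    (hQ0 : 0 ≤ Q) (hQ : ∀ x ∈ Icc (0 : ℝ) 1, |q x| ≤ Q) (hk : 4 * Q ≤ k) (hk0 : 0 < k)
    (hsin : Real.sin k = 0) {s v : ℝ → ℝ} (hs : IsEdgeSolution q (k ^ 2) s v)
    (h0 : s 0 = 0) (h1 : v 0 = 1) : |v 1 * Real.cos k - 1| ≤ 1 / 2 := by
  obtain ⟨x₀, hx₀, hmax⟩ := isCompact_Icc.exists_isMaxOn (nonempty_Icc.2 zero_le_one)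
    (hs.continuousOn_fst.abs)
  set m := |s x₀|
  have hm0 : 0 ≤ m := abs_nonneg _
  have hsm : ∀ x ∈ Icc (0 : ℝ) 1, |s x| ≤ m := fun x hx => hmax hx
  -- Variation of constants: in coordinates rotating with frequency k the k² terms cancel and only q
  -- s drives the motion.
  let a : ℝ → ℝ := fun x => v x * Real.cos (k * x) + k * s x * Real.sin (k * x)
  let b : ℝ → ℝ := fun x => v x * Real.sin (k * x) - k * s x * Real.cos (k * x)
  have hkx : ∀ x : ℝ, HasDerivAt (fun x => k * x) k x := fun x => by
    simpa using (hasDerivAt_id x).const_mul k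
  have hc : ∀ x, HasDerivWithinAt (fun x => Real.cos (k * x)) (-Real.sin (k * x) * k) (Icc 0 1) x :=
    fun x => (hkx x).cos.hasDerivWithinAt
  have hsn : ∀ x, HasDerivWithinAt (fun x => Real.sin (k * x)) (Real.cos (k * x) * k) (Icc 0 1) x :=
    fun x => (hkx x).sin.hasDerivWithinAt
  have ha : ∀ x ∈ Icc (0 : ℝ) 1,
      HasDerivWithinAt a (q x * s x * Real.cos (k * x)) (Icc 0 1) x := fun x hx => by
    refine (((hs x hx).2.mul (hc x)).add (((hs x hx).1.const_mul k).mul (hsn x))).congr_deriv ?_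
    simp only [smul_eq_mul]; ring
  have hb : ∀ x ∈ Icc (0 : ℝ) 1,
      HasDerivWithinAt b (q x * s x * Real.sin (k * x)) (Icc 0 1) x := fun x hx => by
    refine (((hs x hx).2.mul (hsn x)).sub (((hs x hx).1.const_mul k).mul (hc x))).congr_deriv ?_
    simp only [smul_eq_mul]; ring
  have hbd : ∀ x ∈ Icc (0 : ℝ) 1, ∀ y, |y| ≤ 1 → ‖q x * s x * y‖ ≤ Q * m := fun x hx y hy => by
    rw [Real.norm_eq_abs, abs_mul, abs_mul]
    have := mul_le_mul (hQ x hx) (hsm x hx) (abs_nonneg _) hQ0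
    have h5 : 0 ≤ |q x| * |s x| := by positivity
    nlinarith [abs_nonneg y]
  have h00 : (0 : ℝ) ∈ Icc (0 : ℝ) 1 := by simp
  have hlen : ∀ x ∈ Icc (0 : ℝ) 1, Q * m * ‖x - 0‖ ≤ Q * m := fun x hx => by
    rw [sub_zero, Real.norm_eq_abs, abs_of_nonneg hx.1]
    have : 0 ≤ Q * m := by positivity
    nlinarith [hx.2]
  have a1 : ∀ x ∈ Icc (0 : ℝ) 1, |a x - 1| ≤ Q * m := fun x hx => by
    have := (convex_Icc (0 : ℝ) 1).norm_image_sub_le_of_norm_hasDerivWithin_le ha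
      (fun x hx => hbd x hx _ (Real.abs_cos_le_one _)) h00 hx
    have e : a 0 = 1 := by simp [a, h0, h1]
    rw [e] at this
    exact this.trans (hlen x hx)
  have b1 : ∀ x ∈ Icc (0 : ℝ) 1, |b x| ≤ Q * m := fun x hx => by
    have := (convex_Icc (0 : ℝ) 1).norm_image_sub_le_of_norm_hasDerivWithin_le hb
      (fun x hx => hbd x hx _ (Real.abs_sin_le_one _)) h00 hx
    have e : b 0 = 0 := by simp [b, h0]
    rw [e, sub_zero] at this
    exact this.trans (hlen x hx)
  have hks : k * s x₀ = a x₀ * Real.sin (k * x₀) - b x₀ * Real.cos (k * x₀) := by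
    simp only [a, b]
    linear_combination -(k * s x₀) * Real.sin_sq_add_cos_sq (k * x₀)
  -- With 4Q ≤ k this self-referential bound on the maximum m of |s| yields Q m ≤ 1/2, which is the
  -- final error.
  have hkm : k * m ≤ 1 + 2 * (Q * m) := by
    have h6 : k * m = |k * s x₀| := by rw [abs_mul, abs_of_pos hk0]
    rw [h6, hks]
    refine (abs_sub _ _).trans ?_
    rw [abs_mul, abs_mul]
    have h7 : |a x₀| ≤ 1 + Q * m := by
      have := abs_sub_abs_le_abs_sub (a x₀) 1
      rw [abs_one] at this
      linarith [a1 x₀ hx₀]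
    have h8 := mul_le_of_le_one_right (abs_nonneg (a x₀)) (Real.abs_sin_le_one (k * x₀))
    have h9 := mul_le_of_le_one_right (abs_nonneg (b x₀)) (Real.abs_cos_le_one (k * x₀))
    linarith [b1 x₀ hx₀]
  have hend := a1 1 (by simp)
  simp only [a, mul_one, hsin, mul_zero, add_zero] at hend
  nlinarith

end EdgeODE

/-! ### The Dirichlet-to-Neumann map of an edge. -/

section EndPointValues

variable {q : ℝ → ℝ} {E : ℝ} {φ dφ : ℝ → ℝ}

/-- Away from the Dirichlet spectrum a solution is determined by its end point values. -/
theorem IsEdgeSolution.eqOn_zero_of_not_isDirichletEigenvalue (hE : ¬ IsDirichletEigenvalue q E)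
    {u v : ℝ → ℂ} (h : IsEdgeSolution q E u v) (h0 : u 0 = 0) (h1 : u 1 = 0) :
    ∀ x ∈ Icc (0 : ℝ) 1, u x = 0 := by
  intro x hx
  by_contra hne
  have : (u x).re ≠ 0 ∨ (u x).im ≠ 0 := by
    by_contra! hcon
    exact hne (Complex.ext hcon.1 hcon.2)
  rcases this with hre | him
  · exact hE ⟨_, _, h.clm_comp Complex.reCLM, by simp [h0], by simp [h1], x, hx, hre⟩
  · exact hE ⟨_, _, h.clm_comp Complex.imCLM, by simp [h0], by simp [h1], x, hx, him⟩

theorem IsEdgeSolution.zero {V : Type*} [NormedAddCommGroup V] [NormedSpace ℝ V] :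
    IsEdgeSolution q E (fun _ => (0 : V)) (fun _ => 0) := fun x _ =>
  ⟨hasDerivWithinAt_const x _ _, by simpa using hasDerivWithinAt_const x (Icc (0 : ℝ) 1) (0 : V)⟩

theorem IsPhiOne.deriv_zero_ne_zero (hq : ContinuousOn q (Icc 0 1)) (hφ : IsPhiOne q E φ dφ) :
    dφ 0 ≠ 0 := fun h => by
  have := (hφ.1.eqOn_of_initial hq IsEdgeSolution.zero hφ.2.1 h).1 (right_mem_Icc.2 zero_le_one)
  rw [hφ.2.2] at this
  exact one_ne_zero this

/-- `η` is the end point derivative of the sine-type solution. -/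
theorem IsPhiOne.deriv_ratio_eq (hq : ContinuousOn q (Icc 0 1)) (hφ : IsPhiOne q E φ dφ)
    {s v : ℝ → ℝ} (hs : IsEdgeSolution q E s v) (h0 : s 0 = 0) (h1 : v 0 = 1) :
    dφ 1 / dφ 0 = v 1 := by
  have hd := hφ.deriv_zero_ne_zero hq
  have hsc : IsEdgeSolution q E (fun x => dφ 0 * s x) (fun x => dφ 0 * v x) :=
    hs.clm_comp (ContinuousLinearMap.mul ℝ ℝ (dφ 0))
  have := (hφ.1.eqOn_of_initial hq hsc (by simp [h0, hφ.2.1]) (by simp [h1])).2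
    (right_mem_Icc.2 zero_le_one)
  simp only at this
  rw [this, mul_div_cancel_left₀ _ hd]

/-- Rescale s by 1/s(1): if s(1) were 0, then s, nonzero because of its unit initial slope, would be
a Dirichlet eigenfunction. -/
theorem exists_isPhiOne (hE : ¬ IsDirichletEigenvalue q E) {s v : ℝ → ℝ}
    (hs : IsEdgeSolution q E s v) (h0 : s 0 = 0) (h1 : v 0 = 1) :
    ∃ φ dφ, IsPhiOne q E φ dφ := by
  have hs1 : s 1 ≠ 0 := fun hs1 => hE ⟨s, v, hs, h0, hs1, by
    by_contra! hcon
    have := hs.snd_eq_of_fst_eqOn (IsEdgeSolution.zero (V := ℝ)) hcon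
      (left_mem_Icc.2 zero_le_one)
    rw [h1] at this
    exact one_ne_zero this⟩
  exact ⟨_, _, hs.clm_comp (ContinuousLinearMap.mul ℝ ℝ (s 1)⁻¹), by simp [h0], by simp [hs1]⟩

/-- The solution with end point values `a`, `b`. -/
theorem IsPhiOne.isEdgeSolution_combination (hq_even : ∀ x ∈ Icc (0 : ℝ) 1, q (1 - x) = q x)
    (hφ : IsPhiOne q E φ dφ) (a b : ℂ) :
    IsEdgeSolution q E (fun x => a * (φ (1 - x) : ℂ) + b * (φ x : ℂ))
      (fun x => a * (-dφ (1 - x) : ℝ) + b * (dφ x : ℂ)) := by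
  have h1 := ((hφ.1.reflect hq_even).clm_comp Complex.ofRealCLM).clm_comp
    ((ContinuousLinearMap.mul ℝ ℂ) a)
  have h2 := (hφ.1.clm_comp Complex.ofRealCLM).clm_comp ((ContinuousLinearMap.mul ℝ ℂ) b)
  exact h1.add h2

/-- The combination of φ(1 - x) and φ(x) with the same end values differs from u by a solution
vanishing at both ends, hence by zero. -/
theorem IsPhiOne.representation (hq_even : ∀ x ∈ Icc (0 : ℝ) 1, q (1 - x) = q x)
    (hE : ¬ IsDirichletEigenvalue q E) (hφ : IsPhiOne q E φ dφ) {u v : ℝ → ℂ}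
    (h : IsEdgeSolution q E u v) :
    (∀ x ∈ Icc (0 : ℝ) 1, u x = u 0 * φ (1 - x) + u 1 * φ x) ∧
      v 0 = -u 0 * dφ 1 + u 1 * dφ 0 ∧ v 1 = -u 0 * dφ 0 + u 1 * dφ 1 := by
  have hc := hφ.isEdgeSolution_combination hq_even (u 0) (u 1)
  have hz := (h.sub hc).eqOn_zero_of_not_isDirichletEigenvalue hE
    (by simp [hφ.2.1, hφ.2.2]) (by simp [hφ.2.1, hφ.2.2])
  have he : EqOn u (fun x => u 0 * (φ (1 - x) : ℂ) + u 1 * (φ x : ℂ)) (Icc 0 1) :=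
    fun x hx => sub_eq_zero.1 (hz x hx)
  have hd := h.snd_eq_of_fst_eqOn hc he
  refine ⟨he, ?_, ?_⟩
  · rw [hd (left_mem_Icc.2 zero_le_one)]; simp
  · rw [hd (right_mem_Icc.2 zero_le_one)]; simp

end EndPointValues

/-! ### Reduction to the vertex values and the characteristic equation. -/

section VertexSystem

open ComplexConjugate

theorem floquetPhase_mul_conj (θ : ℝ × ℝ) (i : Fin 3) :
    floquetPhase θ i * conj (floquetPhase θ i) = 1 := by
  have h : ∀ t : ℝ, Complex.exp (t * Complex.I) * conj (Complex.exp (t * Complex.I)) = 1 := by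
    intro t
    rw [Complex.mul_conj, Complex.normSq_eq_norm_sq, Complex.norm_exp_ofReal_mul_I]
    simp
  fin_cases i
  · simp [floquetPhase]
  · exact h θ.1
  · exact h θ.2

theorem sum_floquetPhase (θ : ℝ × ℝ) : ∑ i, floquetPhase θ i = structureFactor θ := by
  simp [floquetPhase, structureFactor, Fin.sum_univ_three]

theorem norm_structureFactor_le (θ : ℝ × ℝ) : ‖structureFactor θ‖ ≤ 3 := by
  unfold structureFactor
  refine (norm_add₃_le).trans ?_
  rw [Complex.norm_exp_ofReal_mul_I, Complex.norm_exp_ofReal_mul_I, norm_one]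
  norm_num

/-- The finite system for the vertex values to which the Floquet problem reduces; here `μ` is
`(3 + t₀²) η`. -/
def IsVertexSolution (t₀ μ : ℝ) (αA αB : Fin 2 → ℝ) (F : ℂ) (A B : Fin 2 → ℂ) : Prop :=
  ∀ k, conj F * B k + t₀ ^ 2 * B (1 - k) = (αA k + μ) * A k ∧
    F * A k + t₀ ^ 2 * A (1 - k) = (αB k + μ) * B k

/-- Insert the Dirichlet-to-Neumann map into the flow conditions. Since δ = α φ'(0), the factor
φ'(0) cancels; the three layer edges contribute 3η and the doubly weighted weak edge t₀²η, while the
phases sum to F or its conjugate. -/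
theorem isFloquetEigenvalue_iff {q : ℝ → ℝ} (hq : ContinuousOn q (Icc 0 1))
    (hq_even : ∀ x ∈ Icc (0 : ℝ) 1, q (1 - x) = q x) {t₀ : ℝ} (ht₀ : 0 < t₀)
    (αA αB : Fin 2 → ℝ) (θ : ℝ × ℝ) {E : ℝ} (hE : ¬ IsDirichletEigenvalue q E) {φ dφ : ℝ → ℝ}
    (hφ : IsPhiOne q E φ dφ) :
    IsFloquetEigenvalue q t₀ (fun k => αA k * dφ 0) (fun k => αB k * dφ 0) θ E ↔
      ∃ A B : Fin 2 → ℂ, (∃ k, A k ≠ 0 ∨ B k ≠ 0) ∧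
        IsVertexSolution t₀ ((3 + t₀ ^ 2) * (dφ 1 / dφ 0)) αA αB (structureFactor θ) A B := by
  have hp : (dφ 0 : ℂ) ≠ 0 := by exact_mod_cast hφ.deriv_zero_ne_zero hq
  have ht : (t₀ : ℂ) ≠ 0 := by exact_mod_cast ht₀.ne'
  have hsub : ∀ k : Fin 2, 1 - (1 - k) = k := by decide
  have hph := floquetPhase_mul_conj θ
  have hF := sum_floquetPhase θ
  have hF' : ∑ i, conj (floquetPhase θ i) = conj (structureFactor θ) := by rw [← hF, map_sum]
  have hone : ∑ i, floquetPhase θ i * conj (floquetPhase θ i) = 3 := by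
    simp [hph]
  constructor
  · rintro ⟨u, du, w, dw, A, B, h, x, hx, hne⟩
    have hw0 : ∀ k, w k 0 = t₀ * A k := fun k => by
      rw [← h.cont_weak_A k]; field_simp
    have hw1 : ∀ k, w k 1 = t₀ * B (1 - k) := fun k => by
      rw [← h.cont_weak_B (1 - k), hsub]; field_simp
    have hu1 : ∀ k i, u k i 1 = conj (floquetPhase θ i) * B k := fun k i => by
      rw [← h.cont_B k i]; linear_combination -(u k i 1) * hph i
    have hu := fun k i => hφ.representation hq_even hE (h.layer_eq k i)
    have hw := fun k => hφ.representation hq_even hE (h.weak_eq k)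
    simp only [h.cont_A, hu1] at hu
    simp only [hw0, hw1] at hw
    refine ⟨A, B, ?_, fun k => ⟨?_, ?_⟩⟩
    · by_contra! hcon
      rcases hne with ⟨k, i, hk⟩ | ⟨j, hj⟩
      · apply hk
        rw [(hu k i).1 x hx, (hcon k).1, (hcon k).2]; simp
      · apply hj
        rw [(hw j).1 x hx, (hcon j).1, (hcon (1 - j)).2]; simp
    · have := h.flow_A k
      simp only [(hu k _).2.1, (hw k).2.1, Finset.sum_add_distrib, ← Finset.sum_mul, hF',
        Finset.sum_const, Finset.card_univ, Fintype.card_fin, nsmul_eq_mul] at this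
      apply mul_left_cancel₀ hp
      push_cast at this ⊢
      field_simp
      linear_combination this
    · have := h.flow_B k
      have e : ∀ i, floquetPhase θ i * du k i 1 =
          -(floquetPhase θ i * (A k * dφ 0)) + B k * dφ 1 := fun i => by
        rw [(hu k i).2.2]; linear_combination (B k * dφ 1) * hph i
      simp only [e, (hw _).2.2, Finset.sum_add_distrib, Finset.sum_neg_distrib, ← Finset.sum_mul,
        hF, hsub, Finset.sum_const, Finset.card_univ, Fintype.card_fin, nsmul_eq_mul] at this
      apply mul_left_cancel₀ hp
      push_cast at this ⊢
      field_simp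
      linear_combination this
  · rintro ⟨A, B, hne, hAB⟩
    refine ⟨fun k i x => A k * (φ (1 - x) : ℂ) + (conj (floquetPhase θ i) * B k) * (φ x : ℂ),
      fun k i x => A k * (-dφ (1 - x) : ℝ) + (conj (floquetPhase θ i) * B k) * (dφ x : ℂ),
      fun k x => (t₀ * A k) * (φ (1 - x) : ℂ) + (t₀ * B (1 - k)) * (φ x : ℂ),
      fun k x => (t₀ * A k) * (-dφ (1 - x) : ℝ) + (t₀ * B (1 - k)) * (dφ x : ℂ), A, B, ?_, ?_⟩
    · refine ⟨fun k i => hφ.isEdgeSolution_combination hq_even _ _,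
        fun k => hφ.isEdgeSolution_combination hq_even _ _, fun k i => ?_, fun k i => ?_,
        fun k => ?_, fun k => ?_, fun k => ?_, fun k => ?_⟩
      · simp [hφ.2.1, hφ.2.2]
      · simp only [sub_self, hφ.2.1, hφ.2.2, Complex.ofReal_zero, Complex.ofReal_one]
        linear_combination (B k) * hph i
      · simp [hφ.2.1, hφ.2.2, ht]
      · simp [hφ.2.1, hφ.2.2, ht, hsub]
      · have := (hAB k).1
        simp only [sub_zero, Finset.sum_add_distrib, ← Finset.sum_mul, hF',
          Finset.sum_const, Finset.card_univ, Fintype.card_fin, nsmul_eq_mul]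
        push_cast at this ⊢
        field_simp at this
        linear_combination this
      · have := (hAB k).2
        have e : ∀ i, floquetPhase θ i * (A k * ((-dφ (1 - 1) : ℝ) : ℂ) +
            conj (floquetPhase θ i) * B k * (dφ 1 : ℂ)) =
            -(floquetPhase θ i * (A k * dφ 0)) + B k * dφ 1 := fun i => by
          simp only [sub_self]
          push_cast
          linear_combination (B k * dφ 1) * hph i
        simp only [e, Finset.sum_add_distrib, Finset.sum_neg_distrib, ← Finset.sum_mul,
          hF, hsub, Finset.sum_const, Finset.card_univ, Fintype.card_fin, nsmul_eq_mul]
        simp only [sub_self]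
        push_cast at this ⊢
        field_simp at this
        linear_combination this
    · obtain ⟨k, hA | hB⟩ := hne
      · exact ⟨0, by simp, Or.inl ⟨k, 0, by simpa [hφ.2.1, hφ.2.2] using hA⟩⟩
      · refine ⟨1, by simp, Or.inl ⟨k, 0, ?_⟩⟩
        simpa [hφ.2.1, hφ.2.2, floquetPhase] using hB

/-- The characteristic equation of the vertex system for opposite parameters in the first layer
and vanishing parameters in the second one. -/
theorem IsVertexSolution.characteristic_eq {t₀ μ α : ℝ} {F : ℂ} {A B : Fin 2 → ℂ}
    (h : IsVertexSolution t₀ μ ![α, 0] ![-α, 0] F A B) (hne : ∃ k, A k ≠ 0 ∨ B k ≠ 0) :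
    μ ^ 4 - (α ^ 2 + 2 * ‖F‖ ^ 2 + 2 * t₀ ^ 4) * μ ^ 2 +
      (α ^ 2 * ‖F‖ ^ 2 + ‖F ^ 2 - t₀ ^ 4‖ ^ 2) = 0 := by
  -- Unknowns in the order A 0, B 0, A 1, B 1.
  set M : Matrix (Fin 4) (Fin 4) ℂ :=
    !![-(α + μ), conj F, 0, t₀ ^ 2; F, -(-α + μ), t₀ ^ 2, 0;
       0, t₀ ^ 2, -μ, conj F; t₀ ^ 2, 0, F, -μ] with hM
  have hdet : M.det = 0 := by
    refine Matrix.exists_mulVec_eq_zero_iff.1 ⟨![A 0, B 0, A 1, B 1], ?_, ?_⟩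
    · intro hz
      have h0 := congrFun hz 0
      have h1 := congrFun hz 1
      have h2 := congrFun hz 2
      have h3 := congrFun hz 3
      simp at h0 h1 h2 h3
      obtain ⟨k, hk⟩ := hne
      fin_cases k <;> simp_all
    · obtain ⟨h1, h2⟩ := h 0
      obtain ⟨h3, h4⟩ := h 1
      simp at h1 h2 h3 h4
      ext i
      fin_cases i <;> simp [hM, Matrix.mulVec, dotProduct, Fin.sum_univ_four]
      · linear_combination h1
      · linear_combination h2
      · linear_combination h3
      · linear_combination h4
  have n1 : ((‖F‖ ^ 2 : ℝ) : ℂ) = F * conj F := by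
    rw [Complex.mul_conj, Complex.normSq_eq_norm_sq]
  have n2 : ((‖F ^ 2 - t₀ ^ 4‖ ^ 2 : ℝ) : ℂ) = (F ^ 2 - t₀ ^ 4) * (conj F ^ 2 - t₀ ^ 4) := by
    rw [← Complex.normSq_eq_norm_sq, ← Complex.mul_conj]
    simp
  have key : ((μ ^ 4 - (α ^ 2 + 2 * ‖F‖ ^ 2 + 2 * t₀ ^ 4) * μ ^ 2 +
      (α ^ 2 * ‖F‖ ^ 2 + ‖F ^ 2 - t₀ ^ 4‖ ^ 2) : ℝ) : ℂ) = 0 := by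
    rw [← hdet, hM]
    simp only [Complex.ofReal_add, Complex.ofReal_sub, Complex.ofReal_mul, n1, n2]
    simp [Matrix.det_succ_row_zero, Fin.sum_univ_succ, Fin.succAbove]
    ring
  exact_mod_cast key

end VertexSystem

/-! ### Roots of the characteristic equation and bounds on them. -/

section GapAlgebra

variable {α t₀ : ℝ}

/-- The squares of the two sides differ by 4t₀⁸. -/
theorem sqrt_discriminant_lt (ht₀ : 0 < t₀) :
    √(4 * α ^ 2 * t₀ ^ 4 + α ^ 4) < 2 * t₀ ^ 4 + α ^ 2 := by
  rw [Real.sqrt_lt' (by positivity)]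
  nlinarith [pow_pos ht₀ 8]

theorem gapWidth_pos (ht₀ : 0 < t₀) : 0 < gapWidth α t₀ := by
  have := sqrt_discriminant_lt (α := α) ht₀
  have : 0 < √(2 * t₀ ^ 4 + α ^ 2 - √(4 * α ^ 2 * t₀ ^ 4 + α ^ 4)) :=
    Real.sqrt_pos.2 (by linarith)
  unfold gapWidth
  positivity

theorem gapWidth_lt_outerWidth (ht₀ : 0 < t₀) (hα : α ≠ 0) : gapWidth α t₀ < outerWidth α t₀ := by
  have h := sqrt_discriminant_lt (α := α) ht₀
  have hr : 0 < √(4 * α ^ 2 * t₀ ^ 4 + α ^ 4) := Real.sqrt_pos.2 (by positivity)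
  have := Real.sqrt_lt_sqrt (by linarith)
    (show 2 * t₀ ^ 4 + α ^ 2 - √(4 * α ^ 2 * t₀ ^ 4 + α ^ 4) <
      2 * t₀ ^ 4 + α ^ 2 + √(4 * α ^ 2 * t₀ ^ 4 + α ^ 4) by linarith)
  unfold gapWidth outerWidth
  gcongr

theorem gapWidth_half_sq (ht₀ : 0 < t₀) : ((3 + t₀ ^ 2) * (gapWidth α t₀ / 2)) ^ 2 =
    (2 * t₀ ^ 4 + α ^ 2 - √(4 * α ^ 2 * t₀ ^ 4 + α ^ 4)) / 2 := by
  have h := sqrt_discriminant_lt (α := α) ht₀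
  have e : (3 + t₀ ^ 2) * (gapWidth α t₀ / 2) =
      √2 * √(2 * t₀ ^ 4 + α ^ 2 - √(4 * α ^ 2 * t₀ ^ 4 + α ^ 4)) / 2 := by
    unfold gapWidth
    field_simp
  rw [e, div_pow, mul_pow, Real.sq_sqrt zero_le_two, Real.sq_sqrt (by linarith)]
  ring

theorem outerWidth_half_sq : ((3 + t₀ ^ 2) * (outerWidth α t₀ / 2)) ^ 2 =
    (2 * t₀ ^ 4 + α ^ 2 + √(4 * α ^ 2 * t₀ ^ 4 + α ^ 4)) / 2 := by
  have e : (3 + t₀ ^ 2) * (outerWidth α t₀ / 2) =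
      √2 * √(2 * t₀ ^ 4 + α ^ 2 + √(4 * α ^ 2 * t₀ ^ 4 + α ^ 4)) / 2 := by
    unfold outerWidth
    field_simp
  rw [e, div_pow, mul_pow, Real.sq_sqrt zero_le_two, Real.sq_sqrt (by positivity)]
  ring

/-- The inner root exceeds or equals α², so the inner value of μ² is at most t₀⁴ ≤ 1 and g/2 ≤ 1/(3
+ t₀²). The bound places the gap inside the range that η is shown to cross. -/
theorem gapWidth_half_lt (ht₀ : 0 < t₀) (ht₀_le : t₀ ≤ 1) : gapWidth α t₀ / 2 < 1 / 2 := by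
  have h1 : α ^ 2 ≤ √(4 * α ^ 2 * t₀ ^ 4 + α ^ 4) := by
    apply Real.le_sqrt_of_sq_le
    nlinarith [mul_nonneg (sq_nonneg α) (pow_nonneg ht₀.le 4)]
  have h2 := gapWidth_half_sq (α := α) ht₀
  have h3 : t₀ ^ 4 ≤ 1 := pow_le_one₀ ht₀.le ht₀_le
  have h4 : (3 + t₀ ^ 2) * (gapWidth α t₀ / 2) ≤ 1 := by
    refine (abs_le_one_iff_mul_self_le_one.2 ?_ |> le_of_abs_le)
    rw [← sq]
    linarith
  nlinarith [gapWidth_pos (α := α) ht₀, sq_nonneg t₀]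

/-- The solutions of the characteristic equation at `F = 0`. -/
theorem quartic_eq_zero_iff (ht₀ : 0 < t₀) (η : ℝ) :
    ((3 + t₀ ^ 2) * η) ^ 4 - (α ^ 2 + 2 * t₀ ^ 4) * ((3 + t₀ ^ 2) * η) ^ 2 + t₀ ^ 8 = 0 ↔
      |η| = gapWidth α t₀ / 2 ∨ |η| = outerWidth α t₀ / 2 := by
  have hg := gapWidth_half_sq (α := α) ht₀
  have hG := outerWidth_half_sq (α := α) (t₀ := t₀)
  have hr := Real.sq_sqrt (show 0 ≤ 4 * α ^ 2 * t₀ ^ 4 + α ^ 4 by positivity)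
  have hg0 : 0 ≤ gapWidth α t₀ / 2 := by have := gapWidth_pos (α := α) ht₀; positivity
  have hG0 : 0 ≤ outerWidth α t₀ / 2 := by unfold outerWidth; positivity
  have hs : (3 + t₀ ^ 2) ≠ 0 := by positivity
  -- Vieta in μ²: the two squares have sum α² + 2t₀⁴ and product t₀⁸.
  have hfac : ((3 + t₀ ^ 2) * η) ^ 4 - (α ^ 2 + 2 * t₀ ^ 4) * ((3 + t₀ ^ 2) * η) ^ 2 + t₀ ^ 8 =
      (((3 + t₀ ^ 2) * η) ^ 2 - ((3 + t₀ ^ 2) * (gapWidth α t₀ / 2)) ^ 2) *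
        (((3 + t₀ ^ 2) * η) ^ 2 - ((3 + t₀ ^ 2) * (outerWidth α t₀ / 2)) ^ 2) := by
    rw [hg, hG]
    linear_combination (1 / 4 : ℝ) * hr
  have hsq : ∀ y : ℝ, 0 ≤ y →
      (((3 + t₀ ^ 2) * η) ^ 2 - ((3 + t₀ ^ 2) * y) ^ 2 = 0 ↔ |η| = y) := fun y hy => by
    rw [sub_eq_zero, mul_pow, mul_pow, mul_right_inj' (pow_ne_zero 2 hs), sq_eq_sq_iff_abs_eq_abs,
      abs_of_nonneg hy]
  rw [hfac, mul_eq_zero, hsq _ hg0, hsq _ hG0]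

/-- At `F = 0` the vertex system is solvable exactly on the four branches. -/
theorem exists_isVertexSolution_zero_iff (ht₀ : 0 < t₀) (η : ℝ) :
    (∃ A B : Fin 2 → ℂ, (∃ k, A k ≠ 0 ∨ B k ≠ 0) ∧
      IsVertexSolution t₀ ((3 + t₀ ^ 2) * η) ![α, 0] ![-α, 0] 0 A B) ↔
      |η| = gapWidth α t₀ / 2 ∨ |η| = outerWidth α t₀ / 2 := by
  rw [← quartic_eq_zero_iff ht₀]
  have ht : (t₀ : ℂ) ≠ 0 := by exact_mod_cast ht₀.ne'
  generalize (3 + t₀ ^ 2) * η = μ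
  constructor
  · rintro ⟨A, B, hne, h⟩
    have := h.characteristic_eq hne
    have e : ‖(0 : ℂ) ^ 2 - (t₀ : ℂ) ^ 4‖ = t₀ ^ 4 := by
      simp [abs_of_pos ht₀]
    rw [e, norm_zero] at this
    linear_combination this
  · intro h
    -- At F = 0 the system decouples into the pairs (A 0, B 1) and (B 0, A 1) joined by weak edges;
    -- each factor is the determinant of one pair, up to sign, and (μ, t₀²) is its null vector.
    have hfac : (μ ^ 2 + α * μ - t₀ ^ 4) * (μ ^ 2 - α * μ - t₀ ^ 4) = 0 := by
      linear_combination h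
    rcases mul_eq_zero.1 hfac with h | h
    · have h' : (μ ^ 2 + α * μ - t₀ ^ 4 : ℂ) = 0 := by exact_mod_cast h
      refine ⟨![μ, 0], ![0, t₀ ^ 2], ⟨1, by simp [ht]⟩, fun k => ?_⟩
      fin_cases k
      · constructor
        · simp; linear_combination -h'
        · simp
      · constructor
        · simp
        · simp; ring
    · have h' : (μ ^ 2 - α * μ - t₀ ^ 4 : ℂ) = 0 := by exact_mod_cast h
      refine ⟨![0, t₀ ^ 2], ![μ, 0], ⟨1, by simp [ht]⟩, fun k => ?_⟩
      fin_cases k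
      · constructor
        · simp
        · simp; linear_combination -h'
      · constructor
        · simp; ring
        · simp

/-- A uniform lower bound for the branches over all values of the structure factor. -/
theorem exists_lower_bound_of_characteristic_eq (ht₀ : 0 < t₀) (ht₀_le : t₀ ≤ 1) (hα : α ≠ 0) :
    ∃ ε : ℝ, 0 < ε ∧ ∀ (F : ℂ) (η : ℝ), ‖F‖ ≤ 3 →
      ((3 + t₀ ^ 2) * η) ^ 4 - (α ^ 2 + 2 * ‖F‖ ^ 2 + 2 * t₀ ^ 4) * ((3 + t₀ ^ 2) * η) ^ 2 +
        (α ^ 2 * ‖F‖ ^ 2 + ‖F ^ 2 - t₀ ^ 4‖ ^ 2) = 0 → ε ≤ |η| := by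
  -- The two entries bound the constant term when |F|² is at least, respectively at most, t₀⁴/2.
  set c := min (α ^ 2 * t₀ ^ 4 / 2) (t₀ ^ 8 / 4)
  have hc0 : 0 < c := lt_min (by positivity) (by positivity)
  -- Discarding μ⁴ ≥ 0 leaves c ≤ (α² + 2|F|² + 2t₀⁴)μ², with (3 + t₀²)² ≤ 16 and 2·9 + 2 = 20.
  refine ⟨√(c / (16 * (α ^ 2 + 20))), by positivity, fun F η hF h => ?_⟩
  rw [← Real.sqrt_sq_eq_abs]
  apply Real.sqrt_le_sqrt
  rw [div_le_iff₀ (by positivity)]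
  have ht4 : t₀ ^ 4 ≤ 1 := pow_le_one₀ ht₀.le ht₀_le
  have ht2 : t₀ ^ 2 ≤ 1 := pow_le_one₀ ht₀.le ht₀_le
  have hF0 := norm_nonneg F
  have hF2 : ‖F‖ ^ 2 ≤ 9 := by nlinarith
  have hlow : c ≤ α ^ 2 * ‖F‖ ^ 2 + ‖F ^ 2 - t₀ ^ 4‖ ^ 2 := by
    rcases le_total (t₀ ^ 4 / 2) (‖F‖ ^ 2) with hcase | hcase
    · calc c ≤ α ^ 2 * t₀ ^ 4 / 2 := min_le_left _ _
        _ ≤ α ^ 2 * ‖F‖ ^ 2 := by nlinarith [sq_nonneg α]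
        _ ≤ _ := le_add_of_nonneg_right (sq_nonneg _)
    · have h1 : t₀ ^ 4 / 2 ≤ ‖F ^ 2 - t₀ ^ 4‖ := by
        have := norm_sub_norm_le ((t₀ : ℂ) ^ 4) (F ^ 2)
        rw [norm_sub_rev, norm_pow, norm_pow, Complex.norm_real, Real.norm_eq_abs,
          abs_of_pos ht₀] at this
        linarith
      calc c ≤ t₀ ^ 8 / 4 := min_le_right _ _
        _ = (t₀ ^ 4 / 2) ^ 2 := by ring
        _ ≤ ‖F ^ 2 - t₀ ^ 4‖ ^ 2 := by gcongr
        _ ≤ _ := le_add_of_nonneg_left (by positivity)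
  have hμ : ((3 + t₀ ^ 2) * η) ^ 2 ≤ 16 * η ^ 2 := by
    rw [mul_pow]
    gcongr
    nlinarith [sq_nonneg t₀]
  calc c ≤ (α ^ 2 + 2 * ‖F‖ ^ 2 + 2 * t₀ ^ 4) * ((3 + t₀ ^ 2) * η) ^ 2 := by
        nlinarith [sq_nonneg (((3 + t₀ ^ 2) * η) ^ 2)]
    _ ≤ (α ^ 2 + 20) * (16 * η ^ 2) := by
        exact mul_le_mul (by linarith) hμ (sq_nonneg _) (by positivity)
    _ = η ^ 2 * (16 * (α ^ 2 + 20)) := by ring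

end GapAlgebra

/-! ### An energy interval on which η crosses the gap. -/

section EnergyInterval

/-- Between a large and a small value, a continuous function crosses `[-h, h]` downwards. -/
theorem exists_downcrossing {f : ℝ → ℝ} (hf : Continuous f) {a b h : ℝ} (hab : a < b) (hh : 0 < h)
    (ha : h ≤ f a) (hb : f b ≤ -h) :
    ∃ x y, x < y ∧ f x = h ∧ f y = -h ∧ ∀ z ∈ Ioo x y, |f z| < h := by
  -- Take y as the first point with f ≤ -h, then x as the last point before y with f ≥ h.
  obtain ⟨y, ⟨hyI, hy⟩, hymin⟩ := (isCompact_Icc.inter_right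
    (isClosed_le hf continuous_const)).exists_isLeast
      (⟨b, right_mem_Icc.2 hab.le, hb⟩ : (Icc a b ∩ {z | f z ≤ -h}).Nonempty)
  obtain ⟨x, ⟨hxI, hx⟩, hxmax⟩ := (isCompact_Icc.inter_right
    (isClosed_le continuous_const hf)).exists_isGreatest
      (⟨a, left_mem_Icc.2 hyI.1, ha⟩ : (Icc a y ∩ {z | h ≤ f z}).Nonempty)
  simp only [mem_ofPred_eq] at hx hy
  have hxy : x < y := lt_of_le_of_ne hxI.2 fun e => by rw [e] at hx; linarith
  have hz1 : ∀ z ∈ Ioc x y, f z < h := fun z hz => by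
    by_contra! hcon
    exact absurd (hxmax ⟨⟨hxI.1.trans hz.1.le, hz.2⟩, hcon⟩) (not_le.2 hz.1)
  have hz2 : ∀ z ∈ Ico x y, -h < f z := fun z hz => by
    by_contra! hcon
    exact absurd (hymin ⟨⟨hxI.1.trans hz.1, hz.2.le.trans hyI.2⟩, hcon⟩) (not_le.2 hz.2)
  refine ⟨x, y, hxy, ?_, ?_, fun z hz => abs_lt.2 ⟨hz2 z (Ioo_subset_Ico_self hz),
    hz1 z (Ioo_subset_Ioc_self hz)⟩⟩
  · obtain ⟨z, hz, hfz⟩ := intermediate_value_Icc' hxy.le hf.continuousOn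
      (show h ∈ Icc (f y) (f x) from ⟨by linarith, hx⟩)
    rcases hz.1.eq_or_lt with e | hlt
    · rw [e, hfz]
    · exact absurd hfz (hz1 z ⟨hlt, hz.2⟩).ne
  · obtain ⟨z, hz, hfz⟩ := intermediate_value_Icc' hxy.le hf.continuousOn
      (show -h ∈ Icc (f y) (f x) from ⟨hy, by linarith⟩)
    rcases hz.2.eq_or_lt with e | hlt
    · rw [← e, hfz]
    · exact absurd hfz (hz2 z ⟨hz.1, hlt⟩).ne'

/-- Use the energies k² with k = 2πn and k = (2n+1)π, where cos k = 1 and -1, for n large against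
the bound on q. -/
theorem exists_sine_deriv_one_half {q : ℝ → ℝ} (hq : ContinuousOn q (Icc 0 1)) {s v : ℝ → ℝ → ℝ}
    (hs : ∀ E, IsEdgeSolution q E (s E) (v E)) (h0 : ∀ E, s E 0 = 0) (h1 : ∀ E, v E 0 = 1) :
    ∃ a b, a < b ∧ 1 / 2 ≤ v a 1 ∧ v b 1 ≤ -(1 / 2) := by
  obtain ⟨Q, hQ0, hQ⟩ := hq.exists_abs_le_unitInterval
  obtain ⟨n, hn⟩ := exists_nat_ge (4 * Q + 1)
  have hpi := Real.pi_gt_three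
  have hn0 : (0 : ℝ) ≤ n := n.cast_nonneg
  have hk : (n : ℝ) ≤ n * (2 * Real.pi) := by nlinarith
  have ha := abs_sine_deriv_one_sub_cos_le hQ0 hQ (k := n * (2 * Real.pi)) (by linarith)
    (by linarith) (by
      have := Real.sin_nat_mul_pi (2 * n)
      push_cast at this
      rwa [show (n : ℝ) * (2 * Real.pi) = 2 * n * Real.pi by ring]) (hs _) (h0 _) (h1 _)
  have hb := abs_sine_deriv_one_sub_cos_le hQ0 hQ (k := n * (2 * Real.pi) + Real.pi) (by linarith)
    (by linarith) (by
      have := Real.sin_nat_mul_pi (2 * n + 1)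
      push_cast at this
      rwa [show (n : ℝ) * (2 * Real.pi) + Real.pi = (2 * n + 1) * Real.pi by ring])
    (hs _) (h0 _) (h1 _)
  rw [Real.cos_nat_mul_two_pi, abs_le] at ha
  rw [Real.cos_nat_mul_two_pi_add_pi, abs_le] at hb
  exact ⟨(n * (2 * Real.pi)) ^ 2, (n * (2 * Real.pi) + Real.pi) ^ 2, by nlinarith,
    by linarith [ha.1], by linarith [hb.1]⟩

end EnergyInterval

/-! ### A zero of F, and the assembly of the theorem. -/

theorem exists_structureFactor_eq_zero : ∃ θ ∈ brillouinZone, structureFactor θ = 0 := by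
  have hpi := Real.pi_pos
  have hc : Real.cos (2 * Real.pi / 3) = -(1 / 2) := by
    rw [show 2 * Real.pi / 3 = Real.pi - Real.pi / 3 by ring, Real.cos_pi_sub, Real.cos_pi_div_three]
  -- The three summands of F are then the cube roots of unity.
  refine ⟨(2 * Real.pi / 3, -(2 * Real.pi / 3)),
    ⟨⟨by simp only; linarith, by simp only; linarith⟩,
      ⟨by simp only; linarith, by simp only; linarith⟩⟩, ?_⟩
  have h1 := Complex.exp_ofReal_mul_I_re (2 * Real.pi / 3)
  have h2 := Complex.exp_ofReal_mul_I_im (2 * Real.pi / 3)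
  have h3 := Complex.exp_ofReal_mul_I_re (-(2 * Real.pi / 3))
  have h4 := Complex.exp_ofReal_mul_I_im (-(2 * Real.pi / 3))
  rw [Real.cos_neg] at h3
  rw [Real.sin_neg] at h4
  unfold structureFactor
  apply Complex.ext
  · rw [Complex.add_re, Complex.add_re, h1, h3, hc, Complex.one_re, Complex.zero_re]; norm_num
  · rw [Complex.add_im, Complex.add_im, h2, h4, Complex.one_im, Complex.zero_im]; ring

theorem mainTheorem4 (q : ℝ → ℝ) (hq : ContinuousOn q (Set.Icc 0 1))
    (hq_even : ∀ x ∈ Set.Icc (0 : ℝ) 1, q (1 - x) = q x)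
    (t₀ : ℝ) (ht₀ : 0 < t₀) (ht₀_le : t₀ ≤ 1)
    (αN αB : ℝ) (hne : αN ≠ αB) (hN : αN ≠ 0) (hB : αB ≠ 0) (hopp : αB = -αN) :
    -- the set `F = 0` is non-empty
    (∃ θ ∈ brillouinZone, structureFactor θ = 0) ∧
    -- at `F = 0` the branches take four distinct values, and the inner two enclose a gap around `0`
    (0 < gapWidth αN t₀ ∧ gapWidth αN t₀ < outerWidth αN t₀) ∧
    (∀ θ ∈ brillouinZone, structureFactor θ = 0 →
      ∀ (E : ℝ) (φ dφ : ℝ → ℝ), ¬ IsDirichletEigenvalue q E → IsPhiOne q E φ dφ →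
        (InHBNGrapheneDispersion q t₀ αN αB θ E (dφ 1 / dφ 0) ↔
          |dφ 1 / dφ 0| = gapWidth αN t₀ / 2 ∨ |dφ 1 / dφ 0| = outerWidth αN t₀ / 2)) ∧
    -- both edges of this gap are attained, at the ends of an energy interval free of eigenvalues
    (∃ E₁ E₂ : ℝ, E₁ < E₂ ∧ (∀ E ∈ Set.Icc E₁ E₂, ¬ IsDirichletEigenvalue q E) ∧
      ∀ θ ∈ brillouinZone, structureFactor θ = 0 →
        InHBNGrapheneDispersion q t₀ αN αB θ E₁ (gapWidth αN t₀ / 2) ∧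
        InHBNGrapheneDispersion q t₀ αN αB θ E₂ (-(gapWidth αN t₀ / 2)) ∧
        ∀ E ∈ Set.Ioo E₁ E₂, ∀ η : ℝ, ¬ InHBNGrapheneDispersion q t₀ αN αB θ E η) ∧
    -- the positive and the negative branches stay apart on the whole Brillouin zone
    (∃ ε : ℝ, 0 < ε ∧ ∀ θ ∈ brillouinZone, ∀ E η : ℝ,
      InHBNGrapheneDispersion q t₀ αN αB θ E η → ε ≤ |η|) := by
  subst hopp
  choose s v hs h0 h1 using exists_sine_solution hq
  have hgpos := gapWidth_pos (α := αN) ht₀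
  have hgG := gapWidth_lt_outerWidth ht₀ hN
  have floquet := fun θ E (hE : ¬ IsDirichletEigenvalue q E) φ dφ (hφ : IsPhiOne q E φ dφ) =>
    isFloquetEigenvalue_iff hq hq_even ht₀ ![αN, 0] ![-αN, 0] θ hE hφ
  have branches : ∀ θ, structureFactor θ = 0 → ∀ (E : ℝ) (φ dφ : ℝ → ℝ),
      ¬ IsDirichletEigenvalue q E → IsPhiOne q E φ dφ →
        (InHBNGrapheneDispersion q t₀ αN (-αN) θ E (dφ 1 / dφ 0) ↔
          |dφ 1 / dφ 0| = gapWidth αN t₀ / 2 ∨ |dφ 1 / dφ 0| = outerWidth αN t₀ / 2) := by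
    intro θ hF E φ dφ hE hφ
    have key := floquet θ E hE
    rw [hF] at key
    simp only [exists_isVertexSolution_zero_iff ht₀] at key
    constructor
    · rintro ⟨-, ψ, dψ, hψ, hη, hfl⟩
      rw [hη]
      exact (key ψ dψ hψ).1 hfl
    · exact fun h => ⟨hE, φ, dφ, hφ, rfl, (key φ dφ hφ).2 h⟩
  refine ⟨exists_structureFactor_eq_zero, ⟨hgpos, hgG⟩, fun θ _ => branches θ, ?_, ?_⟩
  · have hlt := gapWidth_half_lt (α := αN) ht₀ ht₀_le
    obtain ⟨a, b, hab, ha, hb⟩ := exists_sine_deriv_one_half hq hs h0 h1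
    obtain ⟨E₁, E₂, h12, hE₁, hE₂, hmid⟩ := exists_downcrossing
      (continuous_sine_deriv_one hq hs h0 h1) hab (half_pos hgpos) (by linarith) (by linarith)
    have hIcc : ∀ E ∈ Icc E₁ E₂, |v E 1| ≤ gapWidth αN t₀ / 2 := fun E hE => by
      rcases hE.1.eq_or_lt with rfl | hl
      · rw [hE₁, abs_of_pos (half_pos hgpos)]
      rcases hE.2.eq_or_lt with rfl | hr
      · rw [hE₂, abs_neg, abs_of_pos (half_pos hgpos)]
      exact (hmid E ⟨hl, hr⟩).le
    -- An eigenvalue would need |s'(1)| = 1, but here |s'(1)| ≤ g/2 < 1/2.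
    have hD : ∀ E ∈ Icc E₁ E₂, ¬ IsDirichletEigenvalue q E := fun E hE hcon => by
      have hsq := sine_deriv_one_sq_of_isDirichletEigenvalue hq hq_even (hs E) (h0 E) (h1 E) hcon
      have := hIcc E hE
      rw [← sq_abs] at hsq
      nlinarith [abs_nonneg (v E 1)]
    have spec : ∀ θ, structureFactor θ = 0 → ∀ E ∈ Icc E₁ E₂,
        (InHBNGrapheneDispersion q t₀ αN (-αN) θ E (v E 1) ↔
          |v E 1| = gapWidth αN t₀ / 2 ∨ |v E 1| = outerWidth αN t₀ / 2) := by
      intro θ hF E hE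
      obtain ⟨φ, dφ, hφ⟩ := exists_isPhiOne (hD E hE) (hs E) (h0 E) (h1 E)
      have := branches θ hF E φ dφ (hD E hE) hφ
      rwa [hφ.deriv_ratio_eq hq (hs E) (h0 E) (h1 E)] at this
    refine ⟨E₁, E₂, h12, hD, fun θ _ hF => ⟨?_, ?_, fun E hE η hcon => ?_⟩⟩
    · have := spec θ hF E₁ (left_mem_Icc.2 h12.le)
      rw [hE₁] at this
      exact this.2 (Or.inl (abs_of_pos (half_pos hgpos)))
    · have := spec θ hF E₂ (right_mem_Icc.2 h12.le)
      rw [hE₂] at this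
      exact this.2 (Or.inl (by rw [abs_neg, abs_of_pos (half_pos hgpos)]))
    · have hη : η = v E 1 := by
        obtain ⟨-, φ, dφ, hφ, hη, -⟩ := hcon
        rw [hη, hφ.deriv_ratio_eq hq (hs E) (h0 E) (h1 E)]
      rw [hη] at hcon
      have hm := hmid E hE
      rcases (spec θ hF E (Ioo_subset_Icc_self hE)).1 hcon with h | h <;> linarith
  · obtain ⟨ε, hε, hbound⟩ := exists_lower_bound_of_characteristic_eq ht₀ ht₀_le hN
    refine ⟨ε, hε, fun θ _ E η => ?_⟩
    rintro ⟨hE, φ, dφ, hφ, rfl, hfl⟩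
    obtain ⟨A, B, hne', hAB⟩ := (floquet θ E hE φ dφ hφ).1 hfl
    exact hbound _ _ (norm_structureFactor_le θ) (hAB.characteristic_eq hne')
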